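/- \textbf{Model.} A dual graph on $n$ nodes is a pair of graphs $G=(V,E)$, $G'=(V,E')$ with $|V|=n$ and $E\subseteq E'$; no geographic constraint is imposed on it. An algorithm consists, for every $n$, of $n$ randomized processes with distinct ids in $[n]$; an adversary assigns the processes bijectively to the nodes. Every process knows from the start the ids of its neighbors in $G$ (advance neighborhood knowledge). Executions proceed in synchronous rounds. In every round each node makes a random choice, independently of the other nodes, whose (discrete) distribution may depend on its id, the ids of its $G$-neighbors, its earlier random choices and what it received in earlier rounds; this information and the new choice determine whether it transmits (and which message) or receives. The communication topology of the round is a graph $H$ with $G\subseteq H\subseteq G'$, and a node $u$ receives the message of $v$ if and only if $u$ is receiving, $v$ is transmitting, and $v$ is the only transmitting neighbor of $u$ in $H$; otherwise $u$ receives nothing. An online adaptive adversary chooses $H$ in each round knowing the network, the algorithm, the id assignment, and all random choices and receptions of all nodes in the earlier rounds, but not the random choices of the current round. After a fixed number of rounds, each node independently outputs $1$ with a probability that the algorithm specifies as a function of the node's id, the ids of its $G$-neighbors and its message history (which messages it received and in which rounds), and outputs $0$ otherwise. The algorithm \emph{solves the MIS problem in $f(n)$ rounds} if there is a constant $p>0$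 such that for every $n$, every dual graph on $n$ nodes, every assignment of the processes to the nodes and every online adaptive adversary, the set of nodes that output $1$ after $f(n)$ rounds is a maximal independent set of $G$ with probability at least $p$. \textbf{Theorem.} Let $f:\mathbb N\to\mathbb N$ and let $\mathcal A$ be an algorithm that solves the MIS problem in $f(n)$ rounds in the online adaptive dual graph model with advance neighborhood knowledge and no geographic constraint. Then for every constant $\epsilon$ with $0<\epsilon\le 1$, $$f(n)=\Omega\!\left(\frac{n^{1-\epsilon}}{\log n}\right),$$ and also $f(n)=\Omega(n^{1-\epsilon})$ for every such $\epsilon$. The two families of bounds are equivalent: a function $F:\mathbb N\to\mathbb R$ satisfies $|F(n)|=\Omega(n^{1-\epsilon}/\log n)$ for all $\epsilon\in(0,1]$ if and only if it satisfies $|F(n)|=\Omega(n^{1-\epsilon})$ for all $\epsilon\in(0,1]$. (Here $F=\Omega(g)$ means that there is a constant $c>0$ with $F(n)\ge c\,g(n)$ for all sufficiently large $n$.) -/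

import Mathlib

open scoped ENNReal

noncomputable section

namespace DualGraphModel

/-! ### Independent products of discrete distributions -/

theorem tsum_pi_prod {α : Type*} (n : ℕ) (p : Fin n → α → ℝ≥0∞) :
    ∑' f : Fin n → α, ∏ i, p i (f i) = ∏ i, ∑' a, p i a := by
  induction n with
  | zero => simp
  | succ n ih =>
    rw [← (Fin.consEquiv (fun _ : Fin (n + 1) => α)).tsum_eq, ENNReal.tsum_prod']
    simp only [Fin.prod_univ_succ, Fin.consEquiv_apply, Fin.cons_zero, Fin.cons_succ]
    simp only [ENNReal.tsum_mul_left, ENNReal.tsum_mul_right]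
    rw [ih (fun i => p i.succ)]

/-- The joint law of `n` independent random values, the `i`-th one with law `p i`. -/
def indep {α : Type*} {n : ℕ} (p : Fin n → PMF α) : PMF (Fin n → α) :=
  ⟨fun f => ∏ i, p i (f i), by
    have h : ∑' f : Fin n → α, ∏ i, p i (f i) = 1 := by
      rw [tsum_pi_prod n (fun i => p i)]
      simp [PMF.tsum_coe]
    exact h ▸ ENNReal.summable.hasSum⟩

/-- A bit that is `true` with probability `p` and `false` with probability `1 - p`. -/
def coin (p : unitInterval) : PMF Bool :=
  PMF.ofFintype (fun b => cond b (ENNReal.ofReal p) (ENNReal.ofReal (1 - p))) (by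
    rw [Fintype.sum_bool]
    simp only [cond_true, cond_false]
    rw [← ENNReal.ofReal_add p.2.1 (sub_nonneg.2 p.2.2)]
    simp)

/-! ### Networks and algorithms -/

/-- A dual graph on `n` nodes: the reliable graph `G` and a supergraph `G'`. No geographic
constraint is imposed. -/
structure DualGraph (n : ℕ) where
  /-- the reliable links -/
  G : SimpleGraph (Fin n)
  /-- the reliable and the unreliable links together -/
  G' : SimpleGraph (Fin n)
  le : G ≤ G'

/-- A randomized process for networks with `n` nodes (ids are elements of `Fin n`), with messages
in `M` and elementary random choices in `R`. The process is given the set `N` of the ids of its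
reliable neighbors (advance neighborhood knowledge). A local history lists, for every earlier round,
newest round first, the random choice that the process made in this round and what it received
(`none`: nothing). -/
structure RadioProcess (n : ℕ) (M R : Type*) where
  /-- the law of the random choice made in the coming round -/
  choose : Set (Fin n) → List (R × Option M) → PMF R
  /-- the action in the coming round, given the random choice made in it: `some m` is to transmit
  `m`, and `none` is to receive -/
  act : Set (Fin n) → List (R × Option M) → R → Option M
  /-- the probability of joining the set at the end, as a function of the neighbor ids and of the
  message history (newest round first) -/
  out : Set (Fin n) → List (Option M) → unitInterval

/-- An algorithm: for every network size `n` and every id in `Fin n`, the process with this id. -/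
def Algorithm (M R : Type*) := (n : ℕ) → Fin n → RadioProcess n M R

/-- The record of one round: for every node, its random choice and what it received. -/
abbrev Round (n : ℕ) (M R : Type*) := Fin n → R × Option M

/-- An online adaptive adversary for the dual graph `D`: it fixes the communication topology of the
coming round, knowing all random choices and receptions of all nodes in the earlier rounds (newest
round first), but not the random choices of the coming round. -/
structure OnlineAdversary {n : ℕ} (D : DualGraph n) (M R : Type*) where
  topology : List (Round n M R) → SimpleGraph (Fin n)
  reliable_le : ∀ h, D.G ≤ topology h
  le_all : ∀ h, topology h ≤ D.G'

/-! ### Executions -/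

open Classical in
/-- What node `u` receives in the communication topology `H` if `a v` is the action of node `v`:
`u` receives the message of its only transmitting neighbor, provided that `u` itself is receiving
and that there is exactly one such neighbor; otherwise it receives nothing. -/
def received {n : ℕ} {M : Type*} (H : SimpleGraph (Fin n)) (a : Fin n → Option M) (u : Fin n) :
    Option M :=
  if h : a u = none ∧ ∃! v, H.Adj u v ∧ a v ≠ none then a (Classical.choose h.2) else none

/-- The ids of the reliable neighbors of node `v`, where `ids` assigns ids (processes) to nodes. -/
def neighborIds {n : ℕ} (D : DualGraph n) (ids : Fin n ≃ Fin n) (v : Fin n) : Set (Fin n) :=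
  ids '' D.G.neighborSet v

section Execution

variable {n : ℕ} {M R : Type*}

/-- The record of the round after the history `h` if the random choices in it are `ω`. -/
def roundRecord (P : Fin n → RadioProcess n M R) (D : DualGraph n) (ids : Fin n ≃ Fin n)
    (adv : OnlineAdversary D M R) (h : List (Round n M R)) (ω : Fin n → R) : Round n M R :=
  fun v => (ω v, received (adv.topology h)
    (fun w => (P (ids w)).act (neighborIds D ids w) (h.map (fun ρ => ρ w)) (ω w)) v)

/-- The law of the history (newest round first) of the first `r` rounds: in every round the nodes
make their random choices independently of each other, each depending on its own local history. -/
def execution (P : Fin n → RadioProcess n M R) (D : DualGraph n) (ids : Fin n ≃ Fin n)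
    (adv : OnlineAdversary D M R) : ℕ → PMF (List (Round n M R))
  | 0 => PMF.pure []
  | r + 1 => (execution P D ids adv r).bind fun h =>
      (indep fun v => (P (ids v)).choose (neighborIds D ids v) (h.map (fun ρ => ρ v))).map
        fun ω => roundRecord P D ids adv h ω :: h

/-- The law of the output bits of the nodes, given the history `h` of the execution. -/
def output (P : Fin n → RadioProcess n M R) (D : DualGraph n) (ids : Fin n ≃ Fin n)
    (h : List (Round n M R)) : PMF (Fin n → Bool) :=
  indep fun v => coin ((P (ids v)).out (neighborIds D ids v) (h.map (fun ρ => (ρ v).2)))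

/-- The law of the output bits of the nodes after `r` rounds. -/
def outputAfter (P : Fin n → RadioProcess n M R) (D : DualGraph n) (ids : Fin n ≃ Fin n)
    (adv : OnlineAdversary D M R) (r : ℕ) : PMF (Fin n → Bool) :=
  (execution P D ids adv r).bind (output P D ids)

end Execution

/-! ### The problem -/

/-- `S` is a maximal independent set of `G`. -/
def IsMIS {V : Type*} (G : SimpleGraph V) (S : Set V) : Prop :=
  (∀ u ∈ S, ∀ v ∈ S, u ≠ v → ¬ G.Adj u v) ∧ ∀ u, u ∉ S → ∃ v ∈ S, G.Adj u v

/-- `A` solves the MIS problem in `f n` rounds in the online adaptive dual graph model: for some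
constant `p > 0`, in every network of every size `n`, under every assignment of the processes to
the nodes and every online adaptive adversary, the output after `f n` rounds is a maximal
independent set of the reliable graph with probability at least `p`. -/
def SolvesMIS {M R : Type*} (A : Algorithm M R) (f : ℕ → ℕ) : Prop :=
  ∃ p : ℝ, 0 < p ∧ ∀ (n : ℕ) (D : DualGraph n) (ids : Fin n ≃ Fin n)
    (adv : OnlineAdversary D M R),
    ENNReal.ofReal p ≤
      (outputAfter (A n) D ids adv (f n)).toOuterMeasure {b | IsMIS D.G {v | b v = true}}

end DualGraphModel

end

/-!
The bounds follow from the stronger bound `f(n) = Ω(n / log n)` (`SolvesMIS.div_log_isBigO`).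

Nodes that receive nothing cannot break symmetry, even if they know the ids of their neighbors.
Consider three nodes and, for two of them, `u` and `w`, the probability `P u {w}` with which `u`
joins the set when its only neighbor is `w` and it never receives a message. If `u` and `w` form an
isolated edge, exactly one of them has to join, so `P u {w}` and `P w {u}` should lie on different
sides of `1/2`. If `u` and `v` are the leaves of a path with center `w`, both have to join or none,
so `P u {w}` and `P v {w}` should lie on the same side. On three nodes these demands contradict each
other, and violating one of them costs a factor `1/2` in the success probability
(`exists_hard_graph`). The hard network consists of `n / 3` disjoint blocks of three nodes, each
joined in a way that is hard for the given processes, with a complete graph of unreliable links.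

The adversary makes most blocks silent. When more than `2 log n` transmitters are expected, it adds
all links: then a message gets through only if exactly one node transmits, which has probability
`O(1 / n)`. Otherwise it adds no links: then every block in which something is received contains a
transmitter. In both cases the expected number of blocks reached per round is `O(log n)`
(`expect_card_heard_le`). If `f(n)` is much smaller than `n / log n`, at least half of the blocks
are likely to stay silent, and the outputs of silent blocks are independent, so that all of them
are correct with exponentially small probability (`expect_output_isMIS_le`).
-/

open scoped ENNReal

noncomputable section

namespace DualGraphModel

/-! ### Expectations of discrete distributions -/

/-- The expectation of an `ℝ≥0∞`-valued function under a discrete distribution. -/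
def expect {α : Type*} (p : PMF α) (g : α → ℝ≥0∞) : ℝ≥0∞ := ∑' a, p a * g a

section Expect

variable {α β : Type*}

theorem expect_pure (a : α) (g : α → ℝ≥0∞) : expect (PMF.pure a) g = g a := by
  rw [expect, tsum_eq_single a]
  · simp
  · intro b hb
    simp [PMF.pure_apply, hb]

theorem expect_bind (p : PMF α) (q : α → PMF β) (g : β → ℝ≥0∞) :
    expect (p.bind q) g = expect p fun a => expect (q a) g := by
  simp only [expect, PMF.bind_apply, ← ENNReal.tsum_mul_right, ← ENNReal.tsum_mul_left]
  rw [ENNReal.tsum_comm]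
  simp only [mul_assoc]

theorem expect_map (p : PMF α) (φ : α → β) (g : β → ℝ≥0∞) :
    expect (p.map φ) g = expect p fun a => g (φ a) := by
  rw [PMF.map, expect_bind]
  simp only [Function.comp, expect_pure]

theorem expect_mono {p : PMF α} {g g' : α → ℝ≥0∞} (h : ∀ a, p a ≠ 0 → g a ≤ g' a) :
    expect p g ≤ expect p g' := by
  refine ENNReal.tsum_le_tsum fun a => ?_
  by_cases ha : p a = 0
  · simp [ha]
  · gcongr
    exact h a ha

theorem expect_const (p : PMF α) (c : ℝ≥0∞) : expect p (fun _ => c) = c := by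
  simp [expect, ENNReal.tsum_mul_right, PMF.tsum_coe]

theorem expect_add (p : PMF α) (g g' : α → ℝ≥0∞) :
    expect p (fun a => g a + g' a) = expect p g + expect p g' := by
  simp only [expect, mul_add, ENNReal.tsum_add]

theorem expect_const_mul (p : PMF α) (c : ℝ≥0∞) (g : α → ℝ≥0∞) :
    expect p (fun a => c * g a) = c * expect p g := by
  simp only [expect, mul_left_comm _ c, ENNReal.tsum_mul_left]

theorem expect_finset_sum {ι : Type*} (p : PMF α) (s : Finset ι) (g : ι → α → ℝ≥0∞) :
    expect p (fun a => ∑ i ∈ s, g i a) = ∑ i ∈ s, expect p (g i) := by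
  classical
  induction s using Finset.induction_on with
  | empty => simp [expect]
  | insert i s hi ih => simp only [Finset.sum_insert hi, expect_add, ih]

theorem toOuterMeasure_eq_expect (p : PMF α) (s : Set α) :
    p.toOuterMeasure s = expect p (s.indicator 1) := by
  rw [PMF.toOuterMeasure_apply, expect]
  refine tsum_congr fun a => ?_
  by_cases ha : a ∈ s <;> simp [ha]

theorem expect_indicator_le_one (p : PMF α) (s : Set α) : expect p (s.indicator 1) ≤ 1 :=
  (expect_mono fun a _ => Set.indicator_le_self' (by simp) a).trans (expect_const p 1).le

theorem expect_indicator_compl (p : PMF α) (s : Set α) :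
    expect p (sᶜ.indicator 1) = 1 - expect p (s.indicator 1) := by
  refine ENNReal.eq_sub_of_add_eq
    ((expect_indicator_le_one p s).trans_lt ENNReal.one_lt_top).ne ?_
  rw [← expect_add, ← expect_const p 1]
  refine congrArg _ (funext fun a => ?_)
  by_cases ha : a ∈ s <;> simp [ha]

theorem expect_coin (p : unitInterval) (g : Bool → ℝ≥0∞) :
    expect (coin p) g = ENNReal.ofReal p * g true + ENNReal.ofReal (1 - p) * g false := by
  simp [expect, coin, tsum_fintype]

theorem expect_indep_prod {n : ℕ} (p : Fin n → PMF α) (g : Fin n → α → ℝ≥0∞) :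
    expect (indep p) (fun ω => ∏ i, g i (ω i)) = ∏ i, expect (p i) (g i) := by
  simp only [expect]
  rw [← tsum_pi_prod n fun i a => p i a * g i a]
  simp only [Finset.prod_mul_distrib]
  rfl

theorem expect_indep_apply {n : ℕ} (p : Fin n → PMF α) (v : Fin n) (g : α → ℝ≥0∞) :
    expect (indep p) (fun ω => g (ω v)) = expect (p v) g := by
  have h := expect_indep_prod p fun i a => if i = v then g a else 1
  simp only [Finset.prod_ite_eq', Finset.mem_univ, if_true] at h
  rw [h, Finset.prod_eq_single v]
  · simp
  · intro i _ hi
    simp [hi, expect_const]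
  · simp

/-- Replacing one coordinate by a fresh independent sample does not change an expectation. -/
theorem expect_indep_update {n : ℕ} (p : Fin n → PMF α) (u : Fin n)
    (F : (Fin n → α) → ℝ≥0∞) :
    expect (indep p) F =
      expect (p u) fun a => expect (indep p) fun ω => F (Function.update ω u a) := by
  let e := (Equiv.funSplitAt u α).symm
  have hu : ∀ x, e x u = x.1 := fun x => by simp [e]
  have hne : ∀ x (j : {j // j ≠ u}), e x j = x.2 j := fun x j => by simp [e, j.2]
  have hupd : ∀ x a, Function.update (e x) u a = e (a, x.2) := by
    intro x a
    funext j
    by_cases hj : j = u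
    · subst hj; simp [hu]
    · rw [Function.update_of_ne hj, hne x ⟨j, hj⟩, hne (a, x.2) ⟨j, hj⟩]
  -- the joint density splits into the density at `u` and a density `w` of the rest
  let w : ({j // j ≠ u} → α) → ℝ≥0∞ := fun y => ∏ j : {j // j ≠ u}, p j (y j)
  have hsplit : ∀ G : (Fin n → α) → ℝ≥0∞,
      expect (indep p) G = ∑' a, p u a * ∑' y, w y * G (e (a, y)) := by
    intro G
    rw [expect, ← e.tsum_eq, ENNReal.tsum_prod']
    refine tsum_congr fun a => ?_
    rw [← ENNReal.tsum_mul_left]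
    refine tsum_congr fun y => ?_
    have : indep p (e (a, y)) = p u a * w y := by
      change ∏ i, p i (e (a, y) i) = _
      rw [Fintype.prod_eq_mul_prod_subtype_ne _ u, hu]
      simp only [hne, w]
    rw [this, mul_assoc]
  have h1 : ∑' a, p u a = 1 := (p u).tsum_coe
  rw [hsplit F, expect]
  refine tsum_congr fun a => ?_
  rw [hsplit]
  simp only [hupd, ENNReal.tsum_mul_right, h1, one_mul]

/-- Events on disjoint pairs of coordinates of an independent family multiply. Disjointness is
expressed by a map `blk` that sends both coordinates of the `i`-th pair to `i`. -/
theorem expect_indep_pairs_le {ι : Type*} {n : ℕ} (p : Fin n → PMF α) (blk : Fin n → ι)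
    (u v : ι → Fin n) (g : ι → α → α → ℝ≥0∞) (c : ℝ≥0∞) (S : Finset ι)
    (hu : ∀ i ∈ S, blk (u i) = i) (hv : ∀ i ∈ S, blk (v i) = i) (huv : ∀ i ∈ S, u i ≠ v i)
    (hc : ∀ i ∈ S, (expect (p (u i)) fun a => expect (p (v i)) fun b => g i a b) ≤ c) :
    expect (indep p) (fun ω => ∏ i ∈ S, g i (ω (u i)) (ω (v i))) ≤ c ^ S.card := by
  classical
  induction S using Finset.induction_on with
  | empty => simp [expect_const]
  | insert i S hi ih =>
    have ih' := ih (fun j hj => hu j (Finset.mem_insert_of_mem hj))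
      (fun j hj => hv j (Finset.mem_insert_of_mem hj))
      (fun j hj => huv j (Finset.mem_insert_of_mem hj))
      (fun j hj => hc j (Finset.mem_insert_of_mem hj))
    have hui := hu i (Finset.mem_insert_self i S)
    have hvi := hv i (Finset.mem_insert_self i S)
    have hne := huv i (Finset.mem_insert_self i S)
    have key : ∀ a b (ω : Fin n → α),
        (∏ j ∈ insert i S, g j (Function.update (Function.update ω (v i) b) (u i) a (u j))
          (Function.update (Function.update ω (v i) b) (u i) a (v j))) =
        g i a b * ∏ j ∈ S, g j (ω (u j)) (ω (v j)) := by
      intro a b ω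
      rw [Finset.prod_insert hi]
      congr 1
      · simp [Function.update_of_ne hne.symm]
      · refine Finset.prod_congr rfl fun j hj => ?_
        have hji : j ≠ i := fun h => hi (h ▸ hj)
        have huj := hu j (Finset.mem_insert_of_mem hj)
        have hvj := hv j (Finset.mem_insert_of_mem hj)
        rw [Function.update_of_ne (fun h => hji (by rw [← huj, h, hui])),
          Function.update_of_ne (fun h => hji (by rw [← huj, h, hvi])),
          Function.update_of_ne (fun h => hji (by rw [← hvj, h, hui])),
          Function.update_of_ne (fun h => hji (by rw [← hvj, h, hvi]))]
    rw [expect_indep_update p (u i)]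
    have : ∀ a, (expect (indep p) fun ω => ∏ j ∈ insert i S,
        g j (Function.update ω (u i) a (u j)) (Function.update ω (u i) a (v j))) =
        expect (indep p) (fun ω => ∏ j ∈ S, g j (ω (u j)) (ω (v j))) *
          expect (p (v i)) fun b => g i a b := by
      intro a
      rw [expect_indep_update p (v i), ← expect_const_mul]
      simp only [key, expect_const_mul, mul_comm]
    simp only [this, expect_const_mul]
    rw [Finset.card_insert_of_notMem hi, pow_succ]
    exact mul_le_mul' ih' (hc i (Finset.mem_insert_self i S))

end Expect

/-! ### Exactly one success among independent trials -/

theorem sum_mul_prod_one_sub_le {n : ℕ} (hn : 0 < n) (x : Fin n → ℝ)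
    (h1 : ∀ v, x v ≤ 1) (hx : 2 * Real.log n ≤ ∑ v, x v) :
    ∑ v, x v * ∏ w ∈ Finset.univ.erase v, (1 - x w) ≤ 3 / n := by
  have hn' : (0 : ℝ) < n := by exact_mod_cast hn
  have hterm : ∀ v, x v * ∏ w ∈ Finset.univ.erase v, (1 - x w) ≤ 3 / (n : ℝ) ^ 2 := by
    intro v
    have hsum : ∑ w ∈ Finset.univ.erase v, x w = (∑ w, x w) - x v := by
      rw [← Finset.add_sum_erase _ _ (Finset.mem_univ v)]; ring
    have hprod : ∏ w ∈ Finset.univ.erase v, (1 - x w) ≤ 3 / (n : ℝ) ^ 2 := by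
      calc ∏ w ∈ Finset.univ.erase v, (1 - x w)
          ≤ ∏ w ∈ Finset.univ.erase v, Real.exp (-x w) :=
            Finset.prod_le_prod (fun w _ => sub_nonneg.2 (h1 w))
              fun w _ => Real.one_sub_le_exp_neg _
        _ = Real.exp (x v - ∑ w, x w) := by
            rw [← Real.exp_sum, Finset.sum_neg_distrib, hsum, neg_sub]
        _ ≤ Real.exp (1 - 2 * Real.log n) := Real.exp_le_exp.2 (by linarith [h1 v])
        _ = Real.exp 1 / (n : ℝ) ^ 2 := by
            rw [Real.exp_sub, two_mul, Real.exp_add, Real.exp_log hn', sq]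
        _ ≤ 3 / (n : ℝ) ^ 2 := by
            gcongr
            exact Real.exp_one_lt_three.le
    have h0p : 0 ≤ ∏ w ∈ Finset.univ.erase v, (1 - x w) :=
      Finset.prod_nonneg fun w _ => sub_nonneg.2 (h1 w)
    exact (mul_le_of_le_one_left h0p (h1 v)).trans hprod
  calc ∑ v, x v * ∏ w ∈ Finset.univ.erase v, (1 - x w)
      ≤ ∑ _v : Fin n, 3 / (n : ℝ) ^ 2 := Finset.sum_le_sum fun v _ => hterm v
    _ = 3 / n := by
        simp only [Finset.sum_const, Finset.card_univ, Fintype.card_fin, nsmul_eq_mul]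
        field_simp

/-- If at least `2 log n` of `n` independent trials succeed in expectation, then it is unlikely
that exactly one succeeds. -/
theorem expect_indep_existsUnique_le {α : Type*} {n : ℕ} (hn : 0 < n) (p : Fin n → PMF α)
    (s : Fin n → Set α)
    (hs : ENNReal.ofReal (2 * Real.log n) ≤ ∑ v, expect (p v) ((s v).indicator 1)) :
    expect (indep p) ({ω | ∃! v, ω v ∈ s v}.indicator 1) ≤ ENNReal.ofReal (3 / n) := by
  have hle := fun v => expect_indicator_le_one (p v) (s v)
  let x : Fin n → ℝ := fun v => (expect (p v) ((s v).indicator 1)).toReal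
  have hx : ∀ v, expect (p v) ((s v).indicator 1) = ENNReal.ofReal (x v) := fun v =>
    (ENNReal.ofReal_toReal ((hle v).trans_lt ENNReal.one_lt_top).ne).symm
  have h0 : ∀ v, 0 ≤ x v := fun v => ENNReal.toReal_nonneg
  have h1 : ∀ v, x v ≤ 1 := fun v =>
    ENNReal.toReal_le_of_le_ofReal zero_le_one (by simpa using hle v)
  have hxc : ∀ v, expect (p v) ((s v)ᶜ.indicator 1) = ENNReal.ofReal (1 - x v) := by
    intro v
    rw [expect_indicator_compl, hx, ENNReal.ofReal_sub _ (h0 v), ENNReal.ofReal_one]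
  have hsum : 2 * Real.log n ≤ ∑ v, x v := by
    simp only [hx] at hs
    rw [← ENNReal.ofReal_sum_of_nonneg fun v _ => h0 v] at hs
    exact (ENNReal.ofReal_le_ofReal_iff (Finset.sum_nonneg fun v _ => h0 v)).1 hs
  calc expect (indep p) ({ω | ∃! v, ω v ∈ s v}.indicator 1)
      ≤ expect (indep p) fun ω => ∑ v, ∏ w,
          (if w = v then (s w).indicator 1 else (s w)ᶜ.indicator 1 : α → ℝ≥0∞) (ω w) := by
        refine expect_mono fun ω _ => ?_
        by_cases hω : ω ∈ {ω : Fin n → α | ∃! v, ω v ∈ s v}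
        swap
        · simp [Set.indicator_of_notMem hω]
        rw [Set.indicator_of_mem hω]
        obtain ⟨v, hv, huniq⟩ := hω
        refine le_trans ?_ (Finset.single_le_sum (fun _ _ => zero_le) (Finset.mem_univ v))
        rw [Finset.prod_eq_one]
        · rfl
        · intro w _
          by_cases hw : w = v
          · subst hw
            rw [if_pos rfl, Set.indicator_of_mem hv, Pi.one_apply]
          · have : ω w ∉ s w := fun h => hw (huniq w h)
            simp [hw, this]
    _ = ∑ v, ENNReal.ofReal (x v * ∏ w ∈ Finset.univ.erase v, (1 - x w)) := by
        rw [expect_finset_sum]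
        refine Finset.sum_congr rfl fun v _ => ?_
        rw [expect_indep_prod, ← Finset.mul_prod_erase _ _ (Finset.mem_univ v),
          ENNReal.ofReal_mul (h0 v), ENNReal.ofReal_prod_of_nonneg fun w _ => sub_nonneg.2 (h1 w)]
        congr 1
        · simp [hx]
        · refine Finset.prod_congr rfl fun w hw => ?_
          rw [if_neg (Finset.ne_of_mem_erase hw), hxc]
    _ ≤ ENNReal.ofReal (3 / n) := by
        rw [← ENNReal.ofReal_sum_of_nonneg fun v _ =>
          mul_nonneg (h0 v) (Finset.prod_nonneg fun w _ => sub_nonneg.2 (h1 w))]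
        exact ENNReal.ofReal_le_ofReal (sum_mul_prod_one_sub_le hn x h1 hsum)

/-! ### The jamming adversary -/

section Received

variable {n : ℕ} {M : Type*} {H : SimpleGraph (Fin n)} {a : Fin n → Option M} {u : Fin n}

theorem existsUnique_of_received_ne_none (h : received H a u ≠ none) :
    a u = none ∧ ∃! v, H.Adj u v ∧ a v ≠ none := by
  by_contra hc
  exact h (dif_neg hc)

theorem existsUnique_of_received_top_ne_none (h : received ⊤ a u ≠ none) :
    ∃! v, a v ≠ none := by
  obtain ⟨hu, v, ⟨_, hv⟩, huniq⟩ := existsUnique_of_received_ne_none h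
  refine ⟨v, hv, fun w hw => huniq w ⟨?_, hw⟩⟩
  rw [SimpleGraph.top_adj]
  rintro rfl
  exact hw hu

end Received

section Jammer

variable {n : ℕ} {M R : Type*} (P : Fin n → RadioProcess n M R) (D : DualGraph n)
  (ids : Fin n ≃ Fin n)

/-- The law of the next random choice of node `v` after the history `h`. -/
def nextChoice (h : List (Round n M R)) (v : Fin n) : PMF R :=
  (P (ids v)).choose (neighborIds D ids v) (h.map fun ρ => ρ v)

/-- The random choices that make node `v` transmit in the round after the history `h`. -/
def transmitting (h : List (Round n M R)) (v : Fin n) : Set R :=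
  {a | (P (ids v)).act (neighborIds D ids v) (h.map fun ρ => ρ v) a ≠ none}

/-- The conditional expectation, given the history `h`, of the number of transmitters in the coming
round. -/
def load (h : List (Round n M R)) : ℝ≥0∞ :=
  ∑ v, expect (nextChoice P D ids h v) ((transmitting P D ids h v).indicator 1)

open Classical in
/-- The adversary that uses only the reliable links if at most `2 log n` transmitters are expected,
and otherwise all links, which form a complete graph. -/
def jammer (hD : D.G' = ⊤) : OnlineAdversary D M R where
  topology h := if load P D ids h ≤ ENNReal.ofReal (2 * Real.log n) then D.G else ⊤
  reliable_le h := by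
    split_ifs
    exacts [le_rfl, le_top]
  le_all h := by
    rw [hD]
    exact le_top

open Classical in
/-- The indices `i < m` of the blocks (fibers of `blk`) in which some node receives a message in
the given round. -/
def heard (blk : Fin n → ℕ) (m : ℕ) (ρ : Round n M R) : Finset ℕ :=
  (Finset.range m).filter fun i => ∃ v, blk v = i ∧ (ρ v).2 ≠ none

open Classical in
/-- The indices `i < m` of the blocks (fibers of `blk`) in which no node ever received a message. -/
def silent (blk : Fin n → ℕ) (m : ℕ) (h : List (Round n M R)) : Finset ℕ :=
  (Finset.range m).filter fun i => ∀ ρ ∈ h, ∀ v, blk v = i → (ρ v).2 = none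

theorem le_card_silent_add (blk : Fin n → ℕ) (m : ℕ) (h : List (Round n M R)) :
    m ≤ (silent blk m h).card + (h.map fun ρ => (heard blk m ρ).card).sum := by
  induction h with
  | nil => simp [silent]
  | cons ρ h ih =>
    have hs : silent blk m (ρ :: h) = silent blk m h \ heard blk m ρ := by
      ext i
      simp only [silent, heard, List.forall_mem_cons, Finset.mem_sdiff, Finset.mem_filter,
        not_and, not_exists, not_not]
      tauto
    have := Finset.le_card_sdiff (heard blk m ρ) (silent blk m h)
    rw [List.map_cons, List.sum_cons, hs]
    omega

/-- Against the jammer, in every round messages are received in `2 log n + 3` blocks at most, in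
expectation. Over the reliable links a block is reached only from within, so a sparse round is
bounded by the number of transmitters; in a dense round nothing is received unless exactly one node
transmits. -/
theorem expect_card_heard_le (hn : 0 < n) (hD : D.G' = ⊤) (blk : Fin n → ℕ)
    (hblk : ∀ u v, D.G.Adj u v → blk u = blk v) {m : ℕ} (hm : m ≤ n) (h : List (Round n M R)) :
    (expect (indep (nextChoice P D ids h)) fun ω =>
      ((heard blk m (roundRecord P D ids (jammer P D ids hD) h ω)).card : ℝ≥0∞)) ≤
      ENNReal.ofReal (2 * Real.log n) + 3 := by
  classical
  by_cases hT : load P D ids h ≤ ENNReal.ofReal (2 * Real.log n)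
  · refine le_trans ?_ (hT.trans le_self_add)
    have hsum : load P D ids h = expect (indep (nextChoice P D ids h)) fun ω =>
        ∑ v, (transmitting P D ids h v).indicator 1 (ω v) := by
      rw [expect_finset_sum]
      refine Finset.sum_congr rfl fun v _ => ?_
      rw [expect_indep_apply (nextChoice P D ids h) v]
    rw [hsum]
    refine expect_mono fun ω _ => ?_
    have hsub : heard blk m (roundRecord P D ids (jammer P D ids hD) h ω) ⊆
        (Finset.univ.filter fun v => ω v ∈ transmitting P D ids h v).image blk := by
      intro i hi
      obtain ⟨_, u, rfl, hu⟩ := Finset.mem_filter.1 hi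
      simp only [roundRecord, jammer, if_pos hT] at hu
      obtain ⟨_, v, ⟨huv, hv⟩, _⟩ := existsUnique_of_received_ne_none hu
      exact Finset.mem_image.2 ⟨v, Finset.mem_filter.2 ⟨Finset.mem_univ v, hv⟩, (hblk u v huv).symm⟩
    calc ((heard blk m (roundRecord P D ids (jammer P D ids hD) h ω)).card : ℝ≥0∞)
        ≤ ((Finset.univ.filter fun v => ω v ∈ transmitting P D ids h v).card : ℝ≥0∞) := by
          exact_mod_cast (Finset.card_le_card hsub).trans Finset.card_image_le
      _ = ∑ v, (transmitting P D ids h v).indicator 1 (ω v) := by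
          simp [Set.indicator_apply, Finset.sum_boole]
  · have h1 := expect_indep_existsUnique_le hn (nextChoice P D ids h) (transmitting P D ids h)
      (le_of_not_ge hT)
    calc (expect (indep (nextChoice P D ids h)) fun ω =>
          ((heard blk m (roundRecord P D ids (jammer P D ids hD) h ω)).card : ℝ≥0∞))
        ≤ expect (indep (nextChoice P D ids h)) fun ω =>
            (n : ℝ≥0∞) * {ω | ∃! v, ω v ∈ transmitting P D ids h v}.indicator 1 ω := by
          refine expect_mono fun ω _ => ?_
          by_cases hω : ω ∈ {ω : Fin n → R | ∃! v, ω v ∈ transmitting P D ids h v}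
          · have : (heard blk m (roundRecord P D ids (jammer P D ids hD) h ω)).card ≤ n :=
              (Finset.card_filter_le _ _).trans (by simpa using hm)
            rw [Set.indicator_of_mem hω]
            simpa using this
          · have : heard blk m (roundRecord P D ids (jammer P D ids hD) h ω) = ∅ := by
              refine Finset.filter_eq_empty_iff.2 ?_
              rintro i _ ⟨u, _, hu⟩
              simp only [roundRecord, jammer, if_neg hT] at hu
              exact hω (existsUnique_of_received_top_ne_none hu)
            simp [this]
      _ ≤ n * ENNReal.ofReal (3 / n) := by
          rw [expect_const_mul]
          gcongr
      _ = 3 := by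
          have hn' : (n : ℝ) ≠ 0 := by exact_mod_cast hn.ne'
          rw [← ENNReal.ofReal_natCast, ← ENNReal.ofReal_mul (by positivity),
            mul_div_cancel₀ _ hn']
          simp
      _ ≤ _ := le_add_self

theorem expect_execution_heard_le (hn : 0 < n) (hD : D.G' = ⊤) (blk : Fin n → ℕ)
    (hblk : ∀ u v, D.G.Adj u v → blk u = blk v) {m : ℕ} (hm : m ≤ n) (r : ℕ) :
    (expect (execution P D ids (jammer P D ids hD) r) fun h =>
      (((h.map fun ρ => (heard blk m ρ).card).sum : ℕ) : ℝ≥0∞)) ≤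
      r * (ENNReal.ofReal (2 * Real.log n) + 3) := by
  induction r with
  | zero => simp [execution, expect_pure]
  | succ r ih =>
    simp only [execution, expect_bind, expect_map, List.map_cons, List.sum_cons, Nat.cast_add,
      expect_add, expect_const, Nat.cast_one, add_mul, one_mul]
    rw [add_comm]
    refine add_le_add ih (le_trans (expect_mono fun h _ => ?_) (expect_const _ _).le)
    exact expect_card_heard_le P D ids hn hD blk hblk hm h

theorem length_of_execution_ne_zero (adv : OnlineAdversary D M R) (r : ℕ)
    (h : List (Round n M R)) (hh : execution P D ids adv r h ≠ 0) : h.length = r := by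
  induction r generalizing h with
  | zero =>
    rw [← PMF.mem_support_iff, execution, PMF.support_pure, Set.mem_singleton_iff] at hh
    simp [hh]
  | succ r ih =>
    rw [← PMF.mem_support_iff, execution, PMF.mem_support_bind_iff] at hh
    obtain ⟨h', hh', hh⟩ := hh
    obtain ⟨ω, _, rfl⟩ := (PMF.mem_support_map_iff _ _ _).1 hh
    simp [ih h' ((PMF.mem_support_iff _ _).1 hh')]

end Jammer

/-! ### Three nodes without communication -/

/-- Two independent bits with biases on the same side of `1/2` differ with probability `1/2` at
most. -/
theorem expect_coin_ne_le {p q : unitInterval} (h : (1 / 2 : ℝ) ≤ p ↔ (1 / 2 : ℝ) ≤ q) :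
    (expect (coin p) fun a => expect (coin q) fun b =>
      ({x : Bool × Bool | x.1 ≠ x.2}.indicator 1 (a, b) : ℝ≥0∞)) ≤ 2⁻¹ := by
  have hp := p.2; have hq := q.2
  have h1 := sub_nonneg.2 hp.2
  have h2 := sub_nonneg.2 hq.2
  simp only [expect_coin]
  simp only [Set.indicator_apply, Set.mem_ofPred_eq, ne_eq, not_true_eq_false, if_false,
    not_false_eq_true, if_true, Pi.one_apply, mul_one, mul_zero, zero_add, add_zero,
    Bool.true_eq_false, Bool.false_eq_true]
  rw [← ENNReal.ofReal_mul hp.1, ← ENNReal.ofReal_mul h1, ← ENNReal.ofReal_add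
    (mul_nonneg hp.1 h2) (mul_nonneg h1 hq.1), ← ENNReal.ofReal_ofNat 2,
    ← ENNReal.ofReal_inv_of_pos two_pos]
  refine ENNReal.ofReal_le_ofReal ?_
  by_cases hh : (1 / 2 : ℝ) ≤ p
  · nlinarith [h.1 hh]
  · have := mt h.2 hh
    push Not at hh this
    nlinarith

/-- Two independent bits with biases on different sides of `1/2` agree with probability `1/2` at
most. -/
theorem expect_coin_eq_le {p q : unitInterval} (h : ¬ ((1 / 2 : ℝ) ≤ p ↔ (1 / 2 : ℝ) ≤ q)) :
    (expect (coin p) fun a => expect (coin q) fun b =>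
      ({x : Bool × Bool | x.1 = x.2}.indicator 1 (a, b) : ℝ≥0∞)) ≤ 2⁻¹ := by
  have hp := p.2; have hq := q.2
  have h1 := sub_nonneg.2 hp.2
  have h2 := sub_nonneg.2 hq.2
  simp only [expect_coin]
  simp only [Set.indicator_apply, Set.mem_ofPred_eq, if_false, if_true, Pi.one_apply,
    mul_one, mul_zero, zero_add, add_zero, Bool.true_eq_false, Bool.false_eq_true]
  rw [← ENNReal.ofReal_mul hp.1, ← ENNReal.ofReal_mul h1, ← ENNReal.ofReal_add
    (mul_nonneg hp.1 hq.1) (mul_nonneg h1 h2), ← ENNReal.ofReal_ofNat 2,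
    ← ENNReal.ofReal_inv_of_pos two_pos]
  refine ENNReal.ofReal_le_ofReal ?_
  by_cases hh : (1 / 2 : ℝ) ≤ p
  · have hh' : ¬ (1 / 2 : ℝ) ≤ q := fun hh' => h (by tauto)
    push Not at hh'
    nlinarith
  · have hh' : (1 / 2 : ℝ) ≤ q := by tauto
    push Not at hh
    nlinarith

section MIS

variable {V : Type*} {G : SimpleGraph V} {b : V → Bool}

theorem IsMIS.ne_of_isolated_edge (h : IsMIS G {v | b v = true}) {u v : V}
    (hu : ∀ w, G.Adj u w ↔ w = v) (huv : u ≠ v) : b u ≠ b v := by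
  intro he
  cases hb : b u
  · obtain ⟨w, hw, hadj⟩ := h.2 u (by simp [hb])
    obtain rfl := (hu w).1 hadj
    simp_all
  · exact h.1 u hb v (he.symm.trans hb) huv ((hu v).2 rfl)

theorem IsMIS.eq_of_common_neighbor (h : IsMIS G {v | b v = true}) {u v c : V}
    (hu : ∀ w, G.Adj u w ↔ w = c) (hv : ∀ w, G.Adj v w ↔ w = c) : b u = b v := by
  have key : ∀ x y : V, (∀ w, G.Adj x w ↔ w = c) → (∀ w, G.Adj y w ↔ w = c) →
      b x = true → b y = true := by
    intro x y hx hy hbx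
    by_contra hby
    obtain ⟨w, hw, hadj⟩ := h.2 y hby
    obtain rfl := (hy w).1 hadj
    have hxw := (hx w).2 rfl
    exact h.1 x hbx w hw hxw.ne hxw
  exact Bool.eq_iff_iff.2 ⟨key u v hu hv, key v u hv hu⟩

end MIS

/-- Three nodes that do not communicate cannot find a maximal independent set reliably: whatever
the probabilities `P v N` are with which a node `v` joins the set when it knows only the set `N` of
its neighbors, the three nodes can be joined by an edge or by a path so that the bits of two of
them, `u` and `v`, have to satisfy a relation, imposed by maximal independence, that holds with
probability `1/2` at most. -/
theorem exists_hard_graph {V : Type*} (P : V → Set V → unitInterval) {x y z : V} (hxy : x ≠ y)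
    (hyz : y ≠ z) (hxz : x ≠ z) :
    ∃ (Γ : SimpleGraph V) (u v : V) (good : Set (Bool × Bool)),
      (∀ a b, Γ.Adj a b → a ∈ ({x, y, z} : Set V)) ∧
      u ∈ ({x, y, z} : Set V) ∧ v ∈ ({x, y, z} : Set V) ∧ u ≠ v ∧
      (∀ G : SimpleGraph V, (∀ a ∈ ({x, y, z} : Set V), ∀ b, G.Adj a b ↔ Γ.Adj a b) →
        ∀ b : V → Bool, IsMIS G {w | b w = true} → (b u, b v) ∈ good) ∧
      (expect (coin (P u (Γ.neighborSet u))) fun s =>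
        expect (coin (P v (Γ.neighborSet v))) fun t =>
          (good.indicator 1 (s, t) : ℝ≥0∞)) ≤ 2⁻¹ := by
  -- `J u v`: a node `u` whose only neighbor is `v` is at least as likely to join as not to
  let J : V → V → Prop := fun u v => (1 / 2 : ℝ) ≤ P u {v}
  by_contra hcon
  have hedge : ∀ u ∈ ({x, y, z} : Set V), ∀ v ∈ ({x, y, z} : Set V), u ≠ v →
      ¬ (J u v ↔ J v u) := by
    intro u hu v hv huv hJ
    have hnu : ∀ w, (SimpleGraph.edge u v).Adj u w ↔ w = v := by
      intro w; rw [SimpleGraph.edge_adj]; grind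
    have hnv : ∀ w, (SimpleGraph.edge u v).Adj v w ↔ w = u := by
      intro w; rw [SimpleGraph.edge_adj]; grind
    refine hcon ⟨SimpleGraph.edge u v, u, v, {x | x.1 ≠ x.2}, ?_, hu, hv, huv, ?_, ?_⟩
    · intro a b hab
      rw [SimpleGraph.edge_adj] at hab
      grind
    · intro G hG b hb
      exact hb.ne_of_isolated_edge (fun w => (hG u hu w).trans (hnu w)) huv
    · have h1 : (SimpleGraph.edge u v).neighborSet u = {v} := Set.ext hnu
      have h2 : (SimpleGraph.edge u v).neighborSet v = {u} := Set.ext hnv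
      rw [h1, h2]
      exact expect_coin_ne_le hJ
  have hpath : ∀ u ∈ ({x, y, z} : Set V), ∀ v ∈ ({x, y, z} : Set V),
      ∀ c ∈ ({x, y, z} : Set V), u ≠ v → u ≠ c → v ≠ c → (J u c ↔ J v c) := by
    intro u hu v hv c hc huv huc hvc
    by_contra hJ
    have hnu : ∀ w, (SimpleGraph.edge u c ⊔ SimpleGraph.edge v c).Adj u w ↔ w = c := by
      intro w; rw [SimpleGraph.sup_adj, SimpleGraph.edge_adj, SimpleGraph.edge_adj]; grind
    have hnv : ∀ w, (SimpleGraph.edge u c ⊔ SimpleGraph.edge v c).Adj v w ↔ w = c := by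
      intro w; rw [SimpleGraph.sup_adj, SimpleGraph.edge_adj, SimpleGraph.edge_adj]; grind
    refine hcon ⟨SimpleGraph.edge u c ⊔ SimpleGraph.edge v c, u, v, {x | x.1 = x.2}, ?_, hu, hv, huv,
      ?_, ?_⟩
    · intro a b hab
      rw [SimpleGraph.sup_adj, SimpleGraph.edge_adj, SimpleGraph.edge_adj] at hab
      grind
    · intro G hG b hb
      exact hb.eq_of_common_neighbor (fun w => (hG u hu w).trans (hnu w))
        fun w => (hG v hv w).trans (hnv w)
    · have h1 : (SimpleGraph.edge u c ⊔ SimpleGraph.edge v c).neighborSet u = {c} := Set.ext hnu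
      have h2 : (SimpleGraph.edge u c ⊔ SimpleGraph.edge v c).neighborSet v = {c} := Set.ext hnv
      rw [h1, h2]
      exact expect_coin_eq_le hJ
  have hx : x ∈ ({x, y, z} : Set V) := by simp
  have hy : y ∈ ({x, y, z} : Set V) := by simp
  have hz : z ∈ ({x, y, z} : Set V) := by simp
  have e1 := hedge x hx y hy hxy
  have e2 := hedge y hy z hz hyz
  have e3 := hedge x hx z hz hxz
  have p1 := hpath x hx y hy z hz hxy hxz hyz
  have p2 := hpath y hy z hz x hx hyz hxy.symm hxz.symm
  have p3 := hpath x hx z hz y hy hxz hxy hyz.symm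
  -- by the edges `J` is a tournament, and by the paths it depends on its second argument only,
  -- which is impossible on three nodes
  tauto

/-! ### The hard network -/

/-- Disjoint hard graphs on the blocks `{3i, 3i+1, 3i+2}`. -/
theorem exists_hard_network {n : ℕ} (hn : 0 < n) (P : Fin n → Set (Fin n) → unitInterval) :
    ∃ (G : SimpleGraph (Fin n)) (u v : ℕ → Fin n) (good : ℕ → Set (Bool × Bool)),
      (∀ a b, G.Adj a b → (a : ℕ) / 3 = b / 3) ∧
      ∀ i < n / 3, (u i : ℕ) / 3 = i ∧ (v i : ℕ) / 3 = i ∧ u i ≠ v i ∧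
        (∀ b : Fin n → Bool, IsMIS G {w | b w = true} → (b (u i), b (v i)) ∈ good i) ∧
        (expect (coin (P (u i) (G.neighborSet (u i)))) fun s =>
          expect (coin (P (v i) (G.neighborSet (v i)))) fun t =>
            ((good i).indicator 1 (s, t) : ℝ≥0∞)) ≤ 2⁻¹ := by
  have hblock : ∀ i, ∃ (Γ : SimpleGraph (Fin n)) (u v : Fin n) (good : Set (Bool × Bool)),
      (∀ a b, Γ.Adj a b → (a : ℕ) / 3 = i) ∧
      (i < n / 3 → (u : ℕ) / 3 = i ∧ (v : ℕ) / 3 = i ∧ u ≠ v ∧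
        (∀ G : SimpleGraph (Fin n), (∀ a : Fin n, (a : ℕ) / 3 = i →
          ∀ b, G.Adj a b ↔ Γ.Adj a b) →
          ∀ b : Fin n → Bool, IsMIS G {w | b w = true} → (b u, b v) ∈ good) ∧
        (expect (coin (P u (Γ.neighborSet u))) fun s =>
          expect (coin (P v (Γ.neighborSet v))) fun t =>
            (good.indicator 1 (s, t) : ℝ≥0∞)) ≤ 2⁻¹) := by
    intro i
    by_cases hi : i < n / 3
    · have h3 : 3 * i + 2 < n := by omega
      let x : Fin n := ⟨3 * i, by omega⟩
      let y : Fin n := ⟨3 * i + 1, by omega⟩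
      let z : Fin n := ⟨3 * i + 2, by omega⟩
      have hmem : ∀ a ∈ ({x, y, z} : Set (Fin n)), (a : ℕ) / 3 = i := by
        rintro a (rfl | rfl | rfl) <;> simp only [x, y, z] <;> omega
      obtain ⟨Γ, u, v, good, hΓ, hu, hv, huv, hgood, hP⟩ := exists_hard_graph P
        (x := x) (y := y) (z := z) (by simp [x, y]) (by simp [y, z]) (by simp [x, z])
      exact ⟨Γ, u, v, good, fun a b h => hmem a (hΓ a b h), fun _ => ⟨hmem u hu, hmem v hv, huv,
        fun G hG => hgood G fun a ha => hG a (hmem a ha), hP⟩⟩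
    · exact ⟨⊥, ⟨0, hn⟩, ⟨0, hn⟩, ∅, by simp, fun h => absurd h hi⟩
  choose Γ u v good hΓ h using hblock
  have hΓ' : ∀ i a b, (Γ i).Adj a b → (b : ℕ) / 3 = i := fun i a b hab => hΓ i b a hab.symm
  let G : SimpleGraph (Fin n) :=
    { Adj := fun a b => (Γ ((a : ℕ) / 3)).Adj a b
      symm := ⟨fun a b hab => by
        rw [hΓ' _ a b hab]
        exact hab.symm⟩
      loopless := ⟨fun a => (Γ _).irrefl⟩ }
  have hG : ∀ i (a : Fin n), (a : ℕ) / 3 = i → ∀ b, G.Adj a b ↔ (Γ i).Adj a b := by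
    rintro i a rfl b
    exact Iff.rfl
  refine ⟨G, u, v, good, fun a b hab => (hΓ' _ a b hab).symm, fun i hi => ?_⟩
  obtain ⟨hu, hv, huv, hgood, hP⟩ := h i hi
  have h1 : G.neighborSet (u i) = (Γ i).neighborSet (u i) := Set.ext (hG i (u i) hu)
  have h2 : G.neighborSet (v i) = (Γ i).neighborSet (v i) := Set.ext (hG i (v i) hv)
  exact ⟨hu, hv, huv, hgood G (hG i), by rwa [h1, h2]⟩

/-- After the history `h`, the output is correct with probability at most `1/2` to the number of
silent blocks, if the outputs of a block that never received a message are correct with probability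
at most `1/2`. -/
theorem expect_output_isMIS_le {n : ℕ} {M R : Type*} (P : Fin n → RadioProcess n M R)
    (D : DualGraph n) (ids : Fin n ≃ Fin n) (blk : Fin n → ℕ) (m : ℕ) (u v : ℕ → Fin n)
    (good : ℕ → Set (Bool × Bool)) (hu : ∀ i < m, blk (u i) = i) (hv : ∀ i < m, blk (v i) = i)
    (huv : ∀ i < m, u i ≠ v i)
    (hmis : ∀ i < m, ∀ b : Fin n → Bool,
      IsMIS D.G {w | b w = true} → (b (u i), b (v i)) ∈ good i)
    (h : List (Round n M R))
    (hgood : ∀ i < m, (expect (coin ((P (ids (u i))).out (neighborIds D ids (u i))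
        (List.replicate h.length none))) fun s =>
      expect (coin ((P (ids (v i))).out (neighborIds D ids (v i))
        (List.replicate h.length none))) fun t =>
        ((good i).indicator 1 (s, t) : ℝ≥0∞)) ≤ 2⁻¹) :
    expect (output P D ids h) ({b | IsMIS D.G {w | b w = true}}.indicator 1) ≤
      2⁻¹ ^ (silent blk m h).card := by
  have hlt : ∀ i ∈ silent blk m h, i < m := fun i hi =>
    Finset.mem_range.1 (Finset.mem_filter.1 hi).1
  have hrep : ∀ i ∈ silent blk m h, ∀ w, blk w = i →
      h.map (fun ρ => (ρ w).2) = List.replicate h.length none := by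
    intro i hi w hw
    refine List.eq_replicate_iff.2 ⟨by simp, fun o ho => ?_⟩
    obtain ⟨ρ, hρ, rfl⟩ := List.mem_map.1 ho
    exact (Finset.mem_filter.1 hi).2 ρ hρ w hw
  refine le_trans (expect_mono fun b _ => ?_)
    (expect_indep_pairs_le _ blk u v (fun i s t => (good i).indicator 1 (s, t)) 2⁻¹
      (silent blk m h) (fun i hi => hu i (hlt i hi)) (fun i hi => hv i (hlt i hi))
      (fun i hi => huv i (hlt i hi)) fun i hi => ?_)
  · by_cases hb : b ∈ {b : Fin n → Bool | IsMIS D.G {w | b w = true}}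
    · rw [Finset.prod_eq_one]
      · exact Set.indicator_le_self' (by simp) b
      · intro i hi
        exact Set.indicator_of_mem (hmis i (hlt i hi) b hb) 1
    · simp [Set.indicator_of_notMem hb]
  · rw [hrep i hi _ (hu i (hlt i hi)), hrep i hi _ (hv i (hlt i hi))]
    exact hgood i (hlt i hi)

/-- The chance of success with `k` silent blocks out of `m`, bounded linearly in the number `c` of
the other blocks: if less than half of the blocks are silent, then `2c / m` is at least `1`. -/
theorem inv_two_pow_le {m k c : ℕ} (hm : 0 < m) (h : m ≤ k + c) :
    (2⁻¹ : ℝ≥0∞) ^ k ≤ 2⁻¹ ^ (m / 2) + (m : ℝ≥0∞)⁻¹ * (2 * c) := by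
  have h2 : (2⁻¹ : ℝ≥0∞) ≤ 1 := ENNReal.inv_le_one.2 one_le_two
  by_cases hk : m / 2 ≤ k
  · exact (pow_le_pow_right_of_le_one' h2 hk).trans le_self_add
  · have hc : m ≤ 2 * c := by omega
    have hm' : (m : ℝ≥0∞) ≠ 0 := by exact_mod_cast hm.ne'
    calc (2⁻¹ : ℝ≥0∞) ^ k ≤ 1 := pow_le_one' h2 k
      _ = (m : ℝ≥0∞)⁻¹ * m := (ENNReal.inv_mul_cancel hm' (ENNReal.natCast_ne_top m)).symm
      _ ≤ (m : ℝ≥0∞)⁻¹ * (2 * c) := by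
          gcongr
          exact_mod_cast hc
      _ ≤ _ := le_add_self

/-- A quantitative form of the lower bound: for all processes there are a network and an adversary
against which a correct output after `r` rounds is unlikely, unless `r` is of order `n / log n` at
least. -/
theorem exists_success_le {n : ℕ} (hn : 3 ≤ n) {M R : Type*} (P : Fin n → RadioProcess n M R)
    (r : ℕ) :
    ∃ (D : DualGraph n) (adv : OnlineAdversary D M R),
      (outputAfter P D (Equiv.refl _) adv r).toOuterMeasure {b | IsMIS D.G {v | b v = true}} ≤
        ENNReal.ofReal ((1 / 2) ^ (n / 3 / 2) +
          ((n / 3 : ℕ) : ℝ)⁻¹ * (2 * (r * (2 * Real.log n + 3)))) := by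
  have hm : 0 < n / 3 := by omega
  have hlog : 0 ≤ Real.log n := Real.log_natCast_nonneg n
  obtain ⟨G, u, v, good, hG, hblock⟩ := exists_hard_network (n := n) (by omega)
    fun w N => (P w).out N (List.replicate r none)
  let D : DualGraph n := ⟨G, ⊤, le_top⟩
  have hnb : ∀ w, neighborIds D (Equiv.refl _) w = G.neighborSet w := fun w => by
    simp [neighborIds, D]
  let blk : Fin n → ℕ := fun w => w / 3
  refine ⟨D, jammer P D (Equiv.refl _) rfl, ?_⟩
  rw [toOuterMeasure_eq_expect, outputAfter, expect_bind]
  calc _ ≤ expect (execution P D (Equiv.refl _) (jammer P D (Equiv.refl _) rfl) r) fun h =>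
        2⁻¹ ^ (n / 3 / 2) + ((n / 3 : ℕ) : ℝ≥0∞)⁻¹ *
          (2 * (((h.map fun ρ => (heard blk (n / 3) ρ).card).sum : ℕ) : ℝ≥0∞)) := by
        refine expect_mono fun h hh => ?_
        have hlen := length_of_execution_ne_zero P D _ _ r h hh
        refine (expect_output_isMIS_le P D _ blk (n / 3) u v good (fun i hi => (hblock i hi).1)
          (fun i hi => (hblock i hi).2.1) (fun i hi => (hblock i hi).2.2.1)
          (fun i hi => (hblock i hi).2.2.2.1) h fun i hi => ?_).trans
          (inv_two_pow_le hm (le_card_silent_add blk (n / 3) h))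
        rw [hlen, hnb, hnb]
        exact (hblock i hi).2.2.2.2
    _ ≤ 2⁻¹ ^ (n / 3 / 2) + ((n / 3 : ℕ) : ℝ≥0∞)⁻¹ *
          (2 * (r * (ENNReal.ofReal (2 * Real.log n) + 3))) := by
        rw [expect_add, expect_const, expect_const_mul, expect_const_mul]
        gcongr
        exact expect_execution_heard_le P D _ (by omega) rfl blk hG (Nat.div_le_self n 3) r
    _ = _ := by
        generalize hT : 2 * Real.log n = T
        have hT0 : 0 ≤ T := by linarith
        rw [ENNReal.ofReal_add (by positivity) (by positivity), ENNReal.ofReal_pow (by positivity),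
          ENNReal.ofReal_mul (by positivity), ENNReal.ofReal_mul two_pos.le,
          ENNReal.ofReal_mul (Nat.cast_nonneg r), ENNReal.ofReal_add hT0 (by positivity),
          ENNReal.ofReal_inv_of_pos (by exact_mod_cast hm)]
        simp

/-! ### Asymptotics -/

open Filter Asymptotics

theorem eventually_one_le_log : ∀ᶠ n : ℕ in atTop, 1 ≤ Real.log n :=
  (Real.tendsto_log_atTop.comp tendsto_natCast_atTop_atTop).eventually_ge_atTop 1

/-- The bound `Ω(n / log n)`, which is stronger than all bounds `Ω(n^(1 - ε))`. -/
theorem SolvesMIS.div_log_isBigO {M R : Type*} {A : Algorithm M R} {f : ℕ → ℕ}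
    (hA : SolvesMIS A f) :
    (fun n : ℕ => (n : ℝ) / Real.log n) =O[atTop] fun n => (f n : ℝ) := by
  obtain ⟨p, hp, hsolve⟩ := hA
  have hpow : ∀ᶠ n : ℕ in atTop, ((1 : ℝ) / 2) ^ (n / 3 / 2) < p / 2 := by
    have h := tendsto_pow_atTop_nhds_zero_of_lt_one (r := (1 : ℝ) / 2) (by norm_num) (by norm_num)
    exact (h.comp ((Nat.tendsto_div_const_atTop two_ne_zero).comp
      (Nat.tendsto_div_const_atTop three_ne_zero))).eventually_lt_const (half_pos hp)
  -- with `m = n / 3 ≥ n / 6` blocks and at most `2 log n + 3 ≤ 5 log n` blocks reached per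
  -- round, the linear term of the success bound is at most `60 f(n) log n / n`, and it has to reach
  -- `p / 2`
  refine IsBigO.of_bound (120 / p) ?_
  filter_upwards [hpow, eventually_one_le_log, eventually_ge_atTop 4] with n hn hlog hn4
  obtain ⟨D, adv, hD⟩ := exists_success_le (by omega) (A n) (f n)
  have hm : (n : ℝ) / 6 ≤ ((n / 3 : ℕ) : ℝ) := by
    have : n ≤ 6 * (n / 3) := by omega
    have : (n : ℝ) ≤ 6 * ((n / 3 : ℕ) : ℝ) := by exact_mod_cast this
    linarith
  have hn0 : (0 : ℝ) < n := by exact_mod_cast (by omega : 0 < n)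
  have hle := (ENNReal.ofReal_le_ofReal_iff (by positivity)).1
    ((hsolve n D (Equiv.refl _) adv).trans hD)
  have hinv : (((n / 3 : ℕ) : ℝ))⁻¹ ≤ 6 / n := by
    rw [← inv_div]
    exact inv_anti₀ (by positivity) hm
  have hmain : p / 2 ≤ 6 / n * (2 * (f n * (5 * Real.log n))) := by
    have h : ((n / 3 : ℕ) : ℝ)⁻¹ * (2 * (f n * (2 * Real.log n + 3))) ≤
        6 / n * (2 * (f n * (5 * Real.log n))) := by
      gcongr
      linarith
    linarith
  have hlog0 : 0 < Real.log n := by linarith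
  rw [Real.norm_of_nonneg (by positivity), Real.norm_of_nonneg (by positivity),
    div_mul_eq_mul_div, div_le_div_iff₀ hlog0 hp]
  have : p / 2 * n ≤ 6 * (2 * (f n * (5 * Real.log n))) := by
    rw [div_mul_eq_mul_div, le_div_iff₀ hn0] at hmain
    exact hmain
  nlinarith

theorem rpow_div_log_isBigO_div_log {ε : ℝ} (hε : 0 < ε) :
    (fun n : ℕ => (n : ℝ) ^ (1 - ε) / Real.log n) =O[atTop]
      fun n : ℕ => (n : ℝ) / Real.log n := by
  refine IsBigO.of_bound 1 ?_
  filter_upwards [eventually_one_le_log, eventually_ge_atTop 1] with n hlog hn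
  have hn' : (1 : ℝ) ≤ n := by exact_mod_cast hn
  rw [one_mul, Real.norm_of_nonneg (by positivity), Real.norm_of_nonneg (by positivity)]
  gcongr
  exact Real.rpow_le_self_of_one_le hn' (by linarith)

theorem rpow_div_log_isBigO_rpow (a : ℝ) :
    (fun n : ℕ => (n : ℝ) ^ a / Real.log n) =O[atTop] fun n : ℕ => (n : ℝ) ^ a := by
  refine IsBigO.of_bound 1 ?_
  filter_upwards [eventually_one_le_log] with n hlog
  rw [one_mul, Real.norm_of_nonneg (by positivity), Real.norm_of_nonneg (by positivity)]
  exact div_le_self (by positivity) hlog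

theorem rpow_isBigO_rpow_div_log {a b : ℝ} (hab : a < b) :
    (fun n : ℕ => (n : ℝ) ^ a) =O[atTop] fun n : ℕ => (n : ℝ) ^ b / Real.log n := by
  obtain ⟨C, hC⟩ := (isLittleO_log_rpow_atTop (sub_pos.2 hab)).isBigO.bound
  refine IsBigO.of_bound C ?_
  filter_upwards [tendsto_natCast_atTop_atTop.eventually hC, eventually_one_le_log,
    eventually_ge_atTop 1] with n hn hlog hn1
  have hn' : (0 : ℝ) < n := by exact_mod_cast hn1
  have hlog0 : 0 < Real.log n := by linarith
  rw [Real.norm_of_nonneg (by positivity), Real.norm_of_nonneg (by positivity)] at hn ⊢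
  rw [← mul_div_assoc, le_div_iff₀ hlog0]
  calc (n : ℝ) ^ a * Real.log n ≤ n ^ a * (C * n ^ (b - a)) := by gcongr
    _ = C * n ^ b := by rw [mul_left_comm, ← Real.rpow_add hn', add_sub_cancel]

theorem forall_rpow_div_log_isBigO_iff (F : ℕ → ℝ) :
    (∀ ε : ℝ, 0 < ε → ε ≤ 1 →
      (fun n : ℕ => (n : ℝ) ^ (1 - ε) / Real.log n) =O[atTop] F) ↔
    (∀ ε : ℝ, 0 < ε → ε ≤ 1 → (fun n : ℕ => (n : ℝ) ^ (1 - ε)) =O[atTop] F) :=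
  ⟨fun h ε h0 h1 => (rpow_isBigO_rpow_div_log (by linarith)).trans
    (h (ε / 2) (by linarith) (by linarith)),
    fun h ε h0 h1 => (rpow_div_log_isBigO_rpow _).trans (h ε h0 h1)⟩

end DualGraphModel

end

theorem mainTheorem1 {M R : Type*} (A : DualGraphModel.Algorithm M R) (f : ℕ → ℕ)
    (hA : DualGraphModel.SolvesMIS A f) :
    (∀ ε : ℝ, 0 < ε → ε ≤ 1 →
      (fun n : ℕ => (n : ℝ) ^ (1 - ε) / Real.log n) =O[Filter.atTop] (fun n : ℕ => (f n : ℝ))) ∧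
    (∀ ε : ℝ, 0 < ε → ε ≤ 1 →
      (fun n : ℕ => (n : ℝ) ^ (1 - ε)) =O[Filter.atTop] (fun n : ℕ => (f n : ℝ))) ∧
    (∀ F : ℕ → ℝ,
      (∀ ε : ℝ, 0 < ε → ε ≤ 1 →
        (fun n : ℕ => (n : ℝ) ^ (1 - ε) / Real.log n) =O[Filter.atTop] F) ↔
      (∀ ε : ℝ, 0 < ε → ε ≤ 1 →
        (fun n : ℕ => (n : ℝ) ^ (1 - ε)) =O[Filter.atTop] F)) := by
  have h : ∀ ε : ℝ, 0 < ε → ε ≤ 1 →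
      (fun n : ℕ => (n : ℝ) ^ (1 - ε) / Real.log n) =O[Filter.atTop] (fun n : ℕ => (f n : ℝ)) :=
    fun ε h0 _ => (DualGraphModel.rpow_div_log_isBigO_div_log h0).trans hA.div_log_isBigO
  exact ⟨h, (DualGraphModel.forall_rpow_div_log_isBigO_iff _).1 h,
    DualGraphModel.forall_rpow_div_log_isBigO_iff⟩
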